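/- Let $R$ be a ring (with $1$) of characteristic zero, so that $\mathbb{N} = \{0, 1, 2, \ldots\} \subseteq \mathbb{Z} \subseteq R$; for instance $R = \mathbb{Z}$, $\mathbb{Q}$, $\mathbb{R}$ or $\mathbb{C}$. Let $s = (s(n))_{n \geq 0}$ be a sequence of natural numbers that is C-recursive over $R$, that is, there are an integer $d \geq 1$ and elements $\alpha_1, \ldots, \alpha_d$ of $R$ with $\alpha_d \neq 0$ such that $$ s(n+d) + \alpha_1 s(n+d-1) + \ldots + \alpha_d s(n) = 0 \quad \text{for every integer } n \geq 0 . $$ Then $s$ is a Kalmar function. That is, there are a deterministic (multi-stack) Turing machine $M$ and an integer $k \geq 0$ such that, for every $n \in \mathbb{N}$, the machine $M$, started on the binary expansion of $n$ (least significant bit first, without leading zeros, so empty for $0$), halts with the binary expansion of $s(n)$, in the same format, as its output after at most $$ T_k(n) = 2^{2^{\iddots^{2^n}}} \quad (k \text{ twos}) $$ steps, where $T_0(n) = n$ and $T_{k+1}(n) = 2^{T_k(n)}$. -/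

import Mathlib

/-- The sequence `s` of elements of the ring `R` is C-recursive: for some `d ≥ 1` and some
coefficients `α 1, …, α d` in `R` with `α d ≠ 0`, one has
`s (n + d) + α 1 * s (n + d - 1) + ⋯ + α d * s n = 0` for every `n ≥ 0`.
(Only the values `α 1, …, α d` of `α` matter, and the subtraction never truncates.) -/
def IsCRecursive {R : Type*} [Ring R] (s : ℕ → R) : Prop :=
  ∃ d : ℕ, 1 ≤ d ∧ ∃ α : ℕ → R, α d ≠ 0 ∧
    ∀ n : ℕ, s (n + d) + ∑ i ∈ Finset.Icc 1 d, α i * s (n + d - i) = 0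

/-- The iterated exponential `2 ^ 2 ^ ⋯ ^ 2 ^ n` with `k` twos. -/
def expTower : ℕ → ℕ → ℕ
  | 0, n => n
  | k + 1, n => 2 ^ expTower k n

/-- `s` is a (univariate) Kalmar function: some deterministic multi-stack Turing machine
with binary input and output alphabets, started on the binary expansion of any `n` (least
significant bit first, no leading zeros, so empty for `0`), halts with
exactly the binary expansion of `s n` as output after at most `expTower k n` steps, where the
height `k` does not depend on `n`. -/
def IsKalmarFunction (s : ℕ → ℕ) : Prop :=
  ∃ (M : Turing.TM2ComputableAux Bool Bool) (k : ℕ), ∀ n : ℕ,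
    Nonempty (Turing.TM2OutputsInTime M.tm
      ((Computability.encodeNat n).map M.inputAlphabet.symm)
      (some ((Computability.encodeNat (s n)).map M.outputAlphabet.symm))
      (expTower k n))

/-!
Since the leading coefficient of the recurrence is `1`, an integer solution is determined by its
first `d` values, so the integer solutions form a finitely generated `ℤ`-module even though the
coefficients only lie in `R`. This module is stable under the shift. Hence `s` is a coordinate of a
sequence of vectors obtained by iterating an integer matrix, and, after separating positive and
negative parts, the difference of two coordinates of the iterates `A ^ n *ᵥ a` of a matrix of
natural numbers. A multi-stack machine that stores numbers in unary computes these iterates by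
repeated additions, in a time bounded by a multiple of `(n + 1) ^ 2` plus the sum of the numbers it
produces. This sum grows at most exponentially with `n`, and exponential growth is absorbed by an
iterated exponential.
-/

/-! ### From a recurrence to a nonnegative matrix -/

section LinearRepresentation

open Matrix

/-- The `ℤ`-module of the integer sequences that satisfy, in the ring `R`, the recurrence of order
`d` with coefficients `α 1, …, α d`. -/
def recurrenceSolutions {R : Type*} [Ring R] (d : ℕ) (α : ℕ → R) : Submodule ℤ (ℕ → ℤ) where
  carrier := {f | ∀ n, (f (n + d) : R) + ∑ i ∈ Finset.Icc 1 d, α i * f (n + d - i) = 0}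
  zero_mem' n := by simp
  add_mem' {f g} hf hg n := by
    have h := congrArg₂ (· + ·) (hf n) (hg n)
    simpa only [Pi.add_apply, Int.cast_add, mul_add, Finset.sum_add_distrib, add_add_add_comm,
      add_zero] using h
  smul_mem' c f hf n := by
    have h := congrArg (c • ·) (hf n)
    simpa only [Pi.smul_apply, smul_eq_mul, Int.cast_mul, ← zsmul_eq_mul, mul_smul_comm,
      Finset.smul_sum, smul_add, smul_zero] using h

variable {R : Type*} [Ring R] {d : ℕ} {α : ℕ → R} {f : ℕ → ℤ}

theorem mem_recurrenceSolutions : f ∈ recurrenceSolutions d α ↔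
    ∀ n, (f (n + d) : R) + ∑ i ∈ Finset.Icc 1 d, α i * f (n + d - i) = 0 := Iff.rfl

theorem shift_mem_recurrenceSolutions (hf : f ∈ recurrenceSolutions d α) :
    (fun n => f (n + 1)) ∈ recurrenceSolutions d α := by
  intro n
  convert hf (n + 1) using 2
  · rw [add_right_comm]
  · refine Finset.sum_congr rfl fun i hi => ?_
    rw [Finset.mem_Icc] at hi
    dsimp only
    rw [show n + d - i + 1 = n + 1 + d - i by omega]

theorem eq_zero_of_mem_recurrenceSolutions [CharZero R] (hf : f ∈ recurrenceSolutions d α)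
    (h0 : ∀ j < d, f j = 0) : f = 0 := by
  funext n
  induction n using Nat.strong_induction_on with
  | _ n ih =>
    rcases lt_or_ge n d with hn | hn
    · exact h0 n hn
    · obtain ⟨k, rfl⟩ := Nat.exists_eq_add_of_le' hn
      have hsum : ∑ i ∈ Finset.Icc 1 d, α i * (f (k + d - i) : R) = 0 := by
        refine Finset.sum_eq_zero fun i hi => ?_
        rw [Finset.mem_Icc] at hi
        rw [ih (k + d - i) (by omega)]
        simp
      simpa [hsum] using hf k

theorem finite_recurrenceSolutions [CharZero R] :
    Module.Finite ℤ (recurrenceSolutions d α) := by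
  let initialValues : recurrenceSolutions d α →ₗ[ℤ] Fin d → ℤ :=
    (LinearMap.funLeft ℤ ℤ (Fin.val : Fin d → ℕ)).domRestrict _
  refine Module.Finite.of_injective initialValues
    ((injective_iff_map_eq_zero initialValues).2 fun f hf => Subtype.ext ?_)
  exact eq_zero_of_mem_recurrenceSolutions f.2 fun j hj => congrFun hf ⟨j, hj⟩

theorem exists_matrix_of_shift_stable {S : Type*} [Semiring S] {M : Submodule S (ℕ → S)}
    (hfg : M.FG) (hshift : ∀ f ∈ M, (fun n => f (n + 1)) ∈ M) {s : ℕ → S} (hs : s ∈ M) :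
    ∃ T : Finset (ℕ → S), s ∈ T ∧ ∃ A : Matrix T T S,
      ∀ n, (fun f : T => f.1 (n + 1)) = A *ᵥ fun f => f.1 n := by
  classical
  obtain ⟨T₀, hT₀⟩ := hfg
  let T := insert s T₀
  have hspan : Submodule.span S (Set.range ((↑) : T → ℕ → S)) = M := by
    rw [Subtype.range_coe, Finset.coe_insert, Submodule.span_insert, hT₀]
    simpa using hs
  have hrow : ∀ f : T, ∃ a : T → S, ∑ g, a g • (g : ℕ → S) = fun n => f.1 (n + 1) := fun f => by
    rw [← Submodule.mem_span_range_iff_exists_fun, hspan]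
    exact hshift _ (hspan ▸ Submodule.subset_span ⟨f, rfl⟩)
  choose A hA using hrow
  refine ⟨T, Finset.mem_insert_self _ _, of A, fun n => funext fun f => ?_⟩
  simpa [mulVec, dotProduct] using (congrFun (hA f) n).symm

theorem exists_nat_matrix_sub {ι : Type*} [Fintype ι] {A : Matrix ι ι ℤ} {z : ℕ → ι → ℤ}
    (hz : ∀ n, z (n + 1) = A *ᵥ z n) :
    ∃ (B : Matrix (ι ⊕ ι) (ι ⊕ ι) ℕ) (x : ℕ → ι ⊕ ι → ℕ), (∀ n, x (n + 1) = B *ᵥ x n) ∧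
      ∀ n i, z n i = x n (.inl i) - x n (.inr i) := by
  let P : Matrix ι ι ℕ := A.map Int.toNat
  let N : Matrix ι ι ℕ := (-A).map Int.toNat
  have hA : ∀ i j, A i j = P i j - N i j := fun i j => (Int.toNat_sub_toNat_neg (A i j)).symm
  let B := fromBlocks P N N P
  let w : ι ⊕ ι → ℕ := Sum.elim (fun i => (z 0 i).toNat) fun i => (-z 0 i).toNat
  let x : ℕ → ι ⊕ ι → ℕ := fun n => B.mulVec^[n] w
  have hx : ∀ n, x (n + 1) = B *ᵥ x n := fun n => Function.iterate_succ_apply' ..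
  refine ⟨B, x, hx, fun n => ?_⟩
  induction n with
  | zero => exact fun i => (Int.toNat_sub_toNat_neg (z 0 i)).symm
  | succ n ih =>
    intro i
    rw [hz, hx, fromBlocks_mulVec]
    simp only [Sum.elim_inl, Sum.elim_inr, Pi.add_apply, mulVec, dotProduct, Function.comp_apply,
      Nat.cast_add, Nat.cast_sum, Nat.cast_mul, ← Finset.sum_add_distrib,
      ← Finset.sum_sub_distrib]
    exact Finset.sum_congr rfl fun j _ => by rw [ih j, hA]; ring

end LinearRepresentation

open Matrix in
theorem IsCRecursive.exists_nat_matrix {R : Type*} [Ring R] [CharZero R] {s : ℕ → ℕ}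
    (hs : IsCRecursive (fun n => (s n : R))) :
    ∃ (ι : Type) (_ : Fintype ι) (A : Matrix ι ι ℕ) (x : ℕ → ι → ℕ) (i j : ι),
      (∀ n, x (n + 1) = A *ᵥ x n) ∧ i ≠ j ∧ ∀ n, s n + x n j = x n i := by
  obtain ⟨d, -, α, -, hα⟩ := hs
  have hmem : (fun n => (s n : ℤ)) ∈ recurrenceSolutions d α :=
    mem_recurrenceSolutions.2 fun n => by simpa using hα n
  obtain ⟨T, hT, A, hA⟩ := exists_matrix_of_shift_stable
    (Module.Finite.iff_fg.1 finite_recurrenceSolutions)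
    (fun _ => shift_mem_recurrenceSolutions) hmem
  obtain ⟨B, x, hB, hx⟩ := exists_nat_matrix_sub (z := fun n (f : T) => f.1 n) hA
  refine ⟨T ⊕ T, inferInstance, B, x, .inl ⟨_, hT⟩, .inr ⟨_, hT⟩, hB, Sum.inl_ne_inr, fun n => ?_⟩
  have := hx n ⟨_, hT⟩
  lia

/-! ### Structured stack programs and their compilation to Turing machines -/

/-- Structured programs acting on binary stacks indexed by `K`. The program `loop k f` pops the
stack `k` and stops if it was empty; otherwise it runs `f b`, where `b` is the popped symbol, and
starts again. -/
inductive StackProgram (K : Type) : Type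
  | skip : StackProgram K
  | push (k : K) (b : Bool) : StackProgram K
  | pop (k : K) : StackProgram K
  | seq (c d : StackProgram K) : StackProgram K
  | loop (k : K) (f : Bool → StackProgram K) : StackProgram K

namespace StackProgram

open Function Turing TM2

variable {K : Type}

section Semantics

variable [DecidableEq K]

/-- `Runs c σ τ t`: started on the stacks `σ`, the program `c` ends on the stacks `τ` after at most
`t` loop tests. Only loop tests count, since each of them compiles to one step of the machine and
the instructions between two of them are executed within a single step. -/
inductive Runs : StackProgram K → (K → List Bool) → (K → List Bool) → ℕ → Prop
  | skip (σ : K → List Bool) : Runs skip σ σ 0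
  | push (k : K) (b : Bool) (σ : K → List Bool) : Runs (push k b) σ (update σ k (b :: σ k)) 0
  | pop (k : K) (σ : K → List Bool) : Runs (pop k) σ (update σ k (σ k).tail) 0
  | seq {c d : StackProgram K} {σ τ ρ : K → List Bool} {s t : ℕ} :
      Runs c σ τ s → Runs d τ ρ t → Runs (seq c d) σ ρ (s + t)
  | loop_nil {k : K} {f : Bool → StackProgram K} {σ : K → List Bool} :
      σ k = [] → Runs (loop k f) σ σ 1
  | loop_cons {k : K} {f : Bool → StackProgram K} {σ τ ρ : K → List Bool} {b : Bool}
      {l : List Bool} {s t : ℕ} :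
      σ k = b :: l → Runs (f b) (update σ k l) τ s → Runs (loop k f) τ ρ t →
        Runs (loop k f) σ ρ (s + t + 1)
  | mono {c : StackProgram K} {σ τ : K → List Bool} {s t : ℕ} :
      Runs c σ τ s → s ≤ t → Runs c σ τ t

end Semantics

/-- The labels of the compiled program: one for each loop. -/
def Label : StackProgram K → Type
  | skip => Empty
  | push _ _ => Empty
  | pop _ => Empty
  | seq c d => c.Label ⊕ d.Label
  | loop _ f => Option (Σ b, (f b).Label)

instance instFintypeLabel : (c : StackProgram K) → Fintype c.Label
  | skip => inferInstanceAs (Fintype Empty)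
  | push _ _ => inferInstanceAs (Fintype Empty)
  | pop _ => inferInstanceAs (Fintype Empty)
  | seq c d =>
    letI := instFintypeLabel c
    letI := instFintypeLabel d
    inferInstanceAs (Fintype (c.Label ⊕ d.Label))
  | loop _ f =>
    letI := fun b => instFintypeLabel (f b)
    inferInstanceAs (Fintype (Option (Σ b, (f b).Label)))

variable {Λ : Type}

/-- The statement that runs `c` up to its first loop test, where `e` places the labels of `c` among
those of the machine and `q` is the statement to execute after `c`. The internal state of the
machine stores the symbol popped by a loop test, and is `none` otherwise. -/
def entry : (c : StackProgram K) → (c.Label → Λ) → Stmt (fun _ : K => Bool) Λ (Option Bool) →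
    Stmt (fun _ : K => Bool) Λ (Option Bool)
  | skip, _, q => q
  | push k b, _, q => .push k (fun _ => b) q
  | pop k, _, q => .pop k (fun v _ => v) q
  | seq c d, e, q => c.entry (e ∘ Sum.inl) (d.entry (e ∘ Sum.inr) q)
  | loop _ _, e, _ => .goto fun _ => e none

/-- The statement of the compiled program at each of its labels, with `e` and `q` as in `entry`. -/
def body : (c : StackProgram K) → (c.Label → Λ) → Stmt (fun _ : K => Bool) Λ (Option Bool) →
    c.Label → Stmt (fun _ : K => Bool) Λ (Option Bool)
  | skip, _, _ => Empty.elim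
  | push _ _, _, _ => Empty.elim
  | pop _, _, _ => Empty.elim
  | seq c d, e, q =>
    Sum.elim (c.body (e ∘ Sum.inl) (d.entry (e ∘ Sum.inr) q)) (d.body (e ∘ Sum.inr) q)
  | loop k f, e, q =>
    let next (b : Bool) := (f b).entry (fun x => e (some ⟨b, x⟩)) (.goto fun _ => e none)
    fun
      | none => .pop k (fun _ o => o) <| .branch Option.isNone q <|
          .branch (· == some true) (.load (fun _ => none) (next true))
            (.load (fun _ => none) (next false))
      | some ⟨b, x⟩ => (f b).body (fun x => e (some ⟨b, x⟩)) (.goto fun _ => e none) x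

section Compile

variable [DecidableEq K]

theorem Runs.evalsToInTime {c : StackProgram K} {σ τ : K → List Bool} {t : ℕ} (h : Runs c σ τ t)
    {M : Λ → Stmt (fun _ : K => Bool) Λ (Option Bool)} {e : c.Label → Λ}
    {q : Stmt (fun _ : K => Bool) Λ (Option Bool)} (hM : ∀ x, M (e x) = c.body e q x) :
    Nonempty (StateTransition.EvalsToInTime (TM2.step M) (stepAux (c.entry e q) none σ)
      (some (stepAux q none τ)) t) := by
  induction h generalizing q with
  | skip => exact ⟨.refl _ _⟩
  | push => exact ⟨.refl _ _⟩
  | pop => exact ⟨.refl _ _⟩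
  | seq _ _ ihc ihd =>
    obtain ⟨hc⟩ := ihc fun x => hM (.inl x)
    obtain ⟨hd⟩ := ihd fun x => hM (.inr x)
    rw [add_comm]
    exact ⟨hc.trans _ _ _ _ _ _ hd⟩
  | @loop_nil k f σ hk =>
    have hempty : update σ k [] = σ := hk ▸ update_eq_self k σ
    have htest : stepAux (M (e none)) none σ = stepAux q none σ :=
      (congrArg (stepAux · none σ) (hM none)).trans (by simp [body, hk, hempty])
    exact ⟨⟨⟨1, congrArg some htest⟩, le_rfl⟩⟩
  | @loop_cons k f σ τ ρ b l s t hk _ _ ihb ihl =>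
    obtain ⟨hb⟩ := ihb (e := fun x => e (some ⟨b, x⟩))
      (q := .goto fun _ => e none) fun x => (hM (some ⟨b, x⟩)).trans (by simp only [body])
    obtain ⟨hl⟩ := ihl hM
    have htest : stepAux (M (e none)) none σ = stepAux ((f b).entry (fun x => e (some ⟨b, x⟩))
        (.goto fun _ => e none)) none (update σ k l) :=
      (congrArg (stepAux · none σ) (hM none)).trans (by cases b <;> simp [body, hk])
    have hstep : StateTransition.EvalsToInTime (TM2.step M)
        (stepAux ((loop k f).entry e q) none σ) _ 1 := ⟨⟨1, congrArg some htest⟩, le_rfl⟩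
    rw [add_comm s]
    exact ⟨hstep.trans _ _ _ _ _ _ (hb.trans _ _ _ _ _ _ hl)⟩
  | mono _ hst ih =>
    obtain ⟨h⟩ := ih hM
    exact ⟨⟨h.toEvalsTo, h.steps_le_m.trans hst⟩⟩

theorem dite_mpr_eq_update (k₀ k : K) (w : List Bool)
    (h : k = k₀ → List Bool = List Bool) :
    (if hk : k = k₀ then (h hk).mpr w else []) = update (fun _ => []) k₀ w k := by
  by_cases hk : k = k₀ <;> simp [hk]

variable [Fintype K]

/-- The Turing machine that runs the program `c` with input on the stack `k₀` and output on the
stack `k₁`. Its label `none` is the starting point, and `some x` is the loop labelled `x`. -/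
def machine (c : StackProgram K) (k₀ k₁ : K) : FinTM2 where
  K := K
  k₀ := k₀
  k₁ := k₁
  Γ _ := Bool
  Λ := Option c.Label
  main := none
  σ := Option Bool
  initialState := none
  Γk₀Fin := inferInstanceAs (Fintype Bool)
  m
    | none => c.entry some .halt
    | some x => c.body some .halt x

theorem initList_machine (c : StackProgram K) (k₀ k₁ : K) (w : List Bool) :
    initList (c.machine k₀ k₁) w = ⟨some none, none, update (fun _ => []) k₀ w⟩ :=
  congrArg (Cfg.mk _ _) (funext fun k => dite_mpr_eq_update k₀ k w fun _ => rfl)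

theorem haltList_machine (c : StackProgram K) (k₀ k₁ : K) (o : List Bool) :
    haltList (c.machine k₀ k₁) o = ⟨none, none, update (fun _ => []) k₁ o⟩ :=
  congrArg (Cfg.mk _ _) (funext fun k => dite_mpr_eq_update k₁ k o fun _ => rfl)

theorem Runs.outputsInTime {c : StackProgram K} {k₀ k₁ : K} {w o : List Bool} {t : ℕ}
    (h : Runs c (update (fun _ => []) k₀ w) (update (fun _ => []) k₁ o) t) :
    Nonempty (TM2OutputsInTime (c.machine k₀ k₁) w (some o) (t + 1)) := by
  obtain ⟨hc⟩ := h.evalsToInTime (M := (c.machine k₀ k₁).m) (e := some) (q := .halt) fun _ => rfl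
  have hstart : StateTransition.EvalsToInTime (c.machine k₀ k₁).step
      (initList (c.machine k₀ k₁) w)
      (some (stepAux (c.entry some .halt) none (update (fun _ => []) k₀ w))) 1 :=
    ⟨⟨1, by rw [initList_machine]; rfl⟩, le_rfl⟩
  have hend : some (haltList (c.machine k₀ k₁) o) =
      some (stepAux .halt none (update (fun _ => []) k₁ o)) :=
    congrArg some (haltList_machine c k₀ k₁ o)
  obtain ⟨⟨n, hn⟩, hle⟩ := hstart.trans _ _ _ _ _ _ hc
  exact ⟨⟨⟨n, hn.trans hend.symm⟩, hle⟩⟩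

end Compile

end StackProgram

/-! ### Binary expansions -/

theorem le_foldl_bit (l : List Bool) (m : ℕ) : m ≤ l.foldl (fun a b => Nat.bit b a) m := by
  induction l generalizing m with
  | nil => rfl
  | cons b l ih =>
    refine le_trans ?_ (ih (Nat.bit b m))
    rw [Nat.bit_val]
    omega

theorem foldr_bit_bits (n : ℕ) : n.bits.foldr Nat.bit 0 = n := by
  induction n using Nat.binaryRec' with
  | zero => simp
  | bit b n h ih => rw [Nat.bits_append_bit n b h, List.foldr_cons, ih]

theorem encodeNat_eq_bits (n : ℕ) : Computability.encodeNat n = n.bits := by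
  have hpos (p : PosNum) : Computability.encodePosNum p = (p : ℕ).bits := by
    induction p with
    | one => simp [Computability.encodePosNum]
    | bit0 p ih =>
      rw [Computability.encodePosNum, ih, PosNum.cast_bit0, ← two_mul, Nat.bit0_bits]
      exact p.to_nat_pos.ne'
    | bit1 p ih =>
      rw [Computability.encodePosNum, ih, PosNum.cast_bit1, ← two_mul, Nat.bit1_bits]
  have hnum (m : Num) : Computability.encodeNum m = (m : ℕ).bits := by
    cases m with
    | zero => simp [Computability.encodeNum]
    | pos p => exact hpos p
  rw [Computability.encodeNat, hnum, Num.to_of_nat]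

/-! ### Arithmetic on unary counters -/

/-- The stacks of a counter program: two binary tapes and the unary counters indexed by `κ`. -/
inductive Tape (κ : Type) : Type
  | inp : Tape κ
  | out : Tape κ
  | ctr (u : κ) : Tape κ
  deriving DecidableEq, Fintype

namespace Tape

open Function

variable {κ : Type}

/-- The stacks with the words `w` and `o` on the binary tapes and the value `x u` in the
counter `u`. -/
def contents (w o : List Bool) (x : κ → ℕ) : Tape κ → List Bool
  | inp => w
  | out => o
  | ctr u => List.replicate (x u) true

theorem contents_nil_nil_zero : contents [] [] (0 : κ → ℕ) = fun _ => [] := by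
  funext k; cases k <;> rfl

variable [DecidableEq κ] (w o l : List Bool) (x : κ → ℕ) (u : κ)

theorem update_inp : update (contents w o x) inp l = contents l o x := by
  funext k; cases k <;> rfl

theorem update_out : update (contents w o x) out l = contents w l x := by
  funext k; cases k <;> rfl

theorem update_ctr (a : ℕ) :
    update (contents w o x) (ctr u) (List.replicate a true) = contents w o (update x u a) := by
  funext k
  rcases k with _ | _ | v
  · rfl
  · rfl
  · rcases eq_or_ne v u with rfl | hv
    · simp [contents]
    · simp [contents, hv]

end Tape

namespace StackProgram

open Function Tape

variable {κ : Type}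

section Counters

variable [DecidableEq κ] {w o : List Bool} {x : κ → ℕ} {r u v : κ}

theorem runs_push_inp (b : Bool) :
    Runs (push inp b) (contents w o x) (contents (b :: w) o x) 0 :=
  update_inp w o (b :: w) x ▸ .push inp b _

theorem runs_push_out (b : Bool) :
    Runs (push out b) (contents w o x) (contents w (b :: o) x) 0 :=
  update_out w o (b :: o) x ▸ .push out b _

theorem runs_pop_inp : Runs (pop inp) (contents w o x) (contents w.tail o x) 0 :=
  update_inp w o w.tail x ▸ .pop inp _

theorem runs_incr :
    Runs (push (ctr u) true) (contents w o x) (contents w o (x + Pi.single u 1)) 0 := by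
  have hx : x + Pi.single u 1 = update x u (x u + 1) := by
    funext v
    rcases eq_or_ne v u with rfl | hv <;> simp [*]
  rw [hx, ← update_ctr]
  exact .push _ _ _

theorem runs_decr : Runs (pop (ctr u)) (contents w o x) (contents w o (x - Pi.single u 1)) 0 := by
  have hx : x - Pi.single u 1 = update x u (x u - 1) := by
    funext v
    rcases eq_or_ne v u with rfl | hv <;> simp [*]
  rw [hx, ← update_ctr, ← List.tail_replicate]
  exact .pop _ _

theorem Runs.loop_inp_cons {f : Bool → StackProgram (Tape κ)} {σ τ : Tape κ → List Bool} {b : Bool}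
    {s t : ℕ} (hbody : Runs (f b) (contents w o x) σ s) (hloop : Runs (loop inp f) σ τ t) :
    Runs (loop inp f) (contents (b :: w) o x) τ (s + t + 1) :=
  .loop_cons rfl (update_inp (b :: w) o w x ▸ hbody) hloop

theorem Runs.loop_out_cons {f : Bool → StackProgram (Tape κ)} {σ τ : Tape κ → List Bool} {b : Bool}
    {s t : ℕ} (hbody : Runs (f b) (contents w o x) σ s) (hloop : Runs (loop out f) σ τ t) :
    Runs (loop out f) (contents w (b :: o) x) τ (s + t + 1) :=
  .loop_cons rfl (update_out w (b :: o) o x ▸ hbody) hloop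

theorem Runs.loop_ctr_zero {f : Bool → StackProgram (Tape κ)} (hu : x u = 0) :
    Runs (loop (ctr u) f) (contents w o x) (contents w o x) 1 :=
  .loop_nil (by simp [contents, hu])

theorem Runs.loop_ctr_succ {f : Bool → StackProgram (Tape κ)} {σ τ : Tape κ → List Bool} {s t : ℕ}
    (hbody : Runs (f true) (contents w o x) σ s) (hloop : Runs (loop (ctr u) f) σ τ t) :
    Runs (loop (ctr u) f) (contents w o (x + Pi.single u 1)) τ (s + t + 1) := by
  refine .loop_cons (b := true) (l := List.replicate (x u) true)
    (by simp [contents, List.replicate_succ]) ?_ hloop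
  rwa [update_ctr, show update (x + Pi.single u 1) u (x u) = x by
    funext v; rcases eq_or_ne v u with rfl | hv <;> simp [*]]

/-- Adds to each counter `u` the number of occurrences of `u` in a list. -/
def addList (l : List κ) : StackProgram (Tape κ) :=
  l.foldr (fun u => seq (push (ctr u) true)) skip

theorem runs_addList (l : List κ) (x : κ → ℕ) :
    Runs (addList l) (contents w o x) (contents w o (x + fun u => l.count u)) 0 := by
  induction l generalizing x with
  | nil => simpa [addList, ← Pi.zero_def] using Runs.skip (contents w o x)
  | cons u l ih =>
    have hcount : x + (fun v => (u :: l).count v) = x + Pi.single u 1 + fun v => l.count v := by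
      funext v
      rcases eq_or_ne u v with rfl | hv
      · simp [add_comm, add_left_comm]
      · simp [hv, hv.symm]
    rw [hcount]
    exact .seq runs_incr (ih _)

/-- Moves the word on the input tape to the output tape, reversing it. -/
def moveInput : StackProgram (Tape κ) :=
  loop inp (push out)

theorem runs_moveInput (w o : List Bool) :
    Runs moveInput (contents w o x) (contents [] (w.reverse ++ o) x) (w.length + 1) := by
  induction w generalizing o with
  | nil => exact .loop_nil rfl
  | cons b w ih =>
    rw [List.reverse_cons, List.append_assoc]
    exact (Runs.loop_inp_cons (runs_push_out b) (ih (b :: o))).mono (by simp)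

/-- Subtracts the counter `u` from the counter `v`, emptying `u`. -/
def subtract (u v : κ) : StackProgram (Tape κ) :=
  loop (ctr u) fun _ => pop (ctr v)

theorem runs_subtract (huv : u ≠ v) (hx : x u = 0) (m : ℕ) :
    Runs (subtract u v) (contents w o (x + Pi.single u m)) (contents w o (x - Pi.single v m))
      (m + 1) := by
  induction m generalizing x with
  | zero => simpa [subtract] using Runs.loop_ctr_zero hx
  | succ m ih =>
    have hloop := ih (x := x - Pi.single v 1) (by simp [hx])
    have hcomm : x + Pi.single u m - Pi.single v 1 = x - Pi.single v 1 + Pi.single u m := by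
      funext k
      rcases eq_or_ne k u with rfl | hk
      · simp [huv]
      · simp [hk]
    rw [← hcomm, tsub_tsub, add_comm (Pi.single v 1), ← Pi.single_add] at hloop
    rw [Pi.single_add, ← add_assoc]
    exact (Runs.loop_ctr_succ runs_decr hloop).mono (by omega)

/-- Adds to the counter `r` the half, rounded up, of the counter `u`, and subtracts the even number
obtained in this way from the counter `v`, emptying `u`. -/
def halve (r u v : κ) : StackProgram (Tape κ) :=
  loop (ctr u) fun _ =>
    seq (push (ctr r) true) (seq (pop (ctr u)) (seq (pop (ctr v)) (pop (ctr v))))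

theorem runs_halve (hru : r ≠ u) (hrv : r ≠ v) (huv : u ≠ v) (hu : x u = 0) (hv : x v = 0)
    (h : ℕ) (b : Bool) :
    Runs (halve r u v)
      (contents w o (x + Pi.single u (2 * h + b.toNat - 1) + Pi.single v (2 * h + b.toNat)))
      (contents w o (x + Pi.single r h + Pi.single v b.toNat)) (h + 1) := by
  induction h generalizing x with
  | zero =>
    have hb : b.toNat - 1 = 0 := by have := b.toNat_le; omega
    simpa [halve, hb] using
      Runs.loop_ctr_zero (u := u) (x := x + Pi.single v b.toNat) (by simp [hu, huv])
  | succ h ih =>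
    let y := x + Pi.single u (2 * h + b.toNat) + Pi.single v (2 * (h + 1) + b.toNat)
    have hbody := Runs.seq (runs_incr (w := w) (o := o) (x := y) (u := r))
      (.seq (runs_decr (u := u)) (.seq (runs_decr (u := v)) (runs_decr (u := v))))
    have hend : y + Pi.single r 1 - Pi.single u 1 - Pi.single v 1 - Pi.single v 1 =
        x + Pi.single r 1 + Pi.single u (2 * h + b.toNat - 1) + Pi.single v (2 * h + b.toNat) := by
      funext k
      simp only [y, Pi.add_apply, Pi.sub_apply, Pi.single_apply]
      grind
    have hloop := ih (x := x + Pi.single r 1) (by simp [hu, hru.symm]) (by simp [hv, hrv.symm])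
    rw [← hend, add_assoc x, ← Pi.single_add, add_comm 1 h] at hloop
    have hstart : x + Pi.single u (2 * (h + 1) + b.toNat - 1) +
        Pi.single v (2 * (h + 1) + b.toNat) = y + Pi.single u 1 := by
      funext k
      simp only [y, Pi.add_apply, Pi.single_apply]
      grind
    rw [hstart]
    exact (Runs.loop_ctr_succ hbody hloop).mono (by omega)

/-- Moves the counter `v`, whose value is `0` or `1`, to the input tape, as one binary digit. -/
def pushDigit (v : κ) : StackProgram (Tape κ) :=
  seq (push inp false) (loop (ctr v) fun _ => seq (pop inp) (push inp true))

theorem runs_pushDigit (hv : x v = 0) (b : Bool) :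
    Runs (pushDigit v) (contents w o (x + Pi.single v b.toNat)) (contents (b :: w) o x) 2 := by
  refine Runs.mono (.seq (runs_push_inp false) ?_) (zero_add 2).le
  cases b
  · simpa using (Runs.loop_ctr_zero hv).mono one_le_two
  · exact .loop_ctr_succ (.seq runs_pop_inp (runs_push_inp true)) (.loop_ctr_zero hv)

section AddVec

variable [Fintype κ]

/-- Adds the vector `g` to the counters. -/
noncomputable def addVec (g : κ → ℕ) : StackProgram (Tape κ) :=
  addList (∑ u, Multiset.replicate (g u) u).toList

theorem runs_addVec (g : κ → ℕ) :
    Runs (addVec g) (contents w o x) (contents w o (x + g)) 0 := by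
  have hg : (fun u => (∑ u, Multiset.replicate (g u) u).toList.count u) = g := by
    funext u
    rw [← Multiset.coe_count, Multiset.coe_toList, Multiset.count_sum']
    simp [Multiset.count_replicate]
  have h := runs_addList (w := w) (o := o) (∑ u, Multiset.replicate (g u) u).toList x
  rwa [hg] at h

/-- Empties the counter `u`, adding the vector `g` to the counters for each unit removed. -/
noncomputable def distribute (u : κ) (g : κ → ℕ) : StackProgram (Tape κ) :=
  loop (ctr u) fun _ => addVec g

theorem runs_distribute {g : κ → ℕ} (hg : g u = 0) (hx : x u = 0) (m : ℕ) :
    Runs (distribute u g) (contents w o (x + Pi.single u m)) (contents w o (x + m • g))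
      (m + 1) := by
  induction m generalizing x with
  | zero => simpa [distribute] using Runs.loop_ctr_zero hx
  | succ m ih =>
    have hloop := ih (x := x + g) (by simp [hx, hg])
    rw [add_right_comm] at hloop
    rw [Pi.single_add, ← add_assoc, succ_nsmul', ← add_assoc]
    exact (Runs.loop_ctr_succ (runs_addVec g) hloop).mono (by omega)

section DistributeAll

variable {ι : Type}

/-- Empties the counters `e i`, for `i` in a list, adding the vector `g i` to the counters for each
unit removed from `e i`. -/
noncomputable def distributeList (e : ι → κ) (g : ι → κ → ℕ) (l : List ι) :
    StackProgram (Tape κ) :=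
  l.foldr (fun i => seq (distribute (e i) (g i))) skip

theorem runs_distributeList {e : ι → κ} (he : Injective e) {g : ι → κ → ℕ}
    (hg : ∀ i j, g i (e j) = 0) (hx : ∀ i, x (e i) = 0) (a : ι → ℕ) {l : List ι} (hl : l.Nodup) :
    Runs (distributeList e g l) (contents w o (x + (l.map fun i => Pi.single (e i) (a i)).sum))
      (contents w o (x + (l.map fun i => a i • g i).sum)) (l.map fun i => a i + 1).sum := by
  induction l generalizing x with
  | nil => exact .skip _
  | cons i l ih =>
    obtain ⟨hi, hl⟩ := List.nodup_cons.1 hl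
    have hrest : (l.map fun j => (Pi.single (e j) (a j) : κ → ℕ)).sum (e i) = 0 := by
      rw [Pi.list_sum_apply, List.map_map]
      refine List.sum_eq_zero fun b hb => ?_
      obtain ⟨j, hj, rfl⟩ := List.mem_map.1 hb
      exact Pi.single_eq_of_ne (he.ne (ne_of_mem_of_not_mem hj hi).symm) _
    have h := runs_distribute (w := w) (o := o) (hg i i)
      (x := x + (l.map fun j => Pi.single (e j) (a j)).sum) (by simp [hx, hrest]) (a i)
    have hloop := ih (x := x + a i • g i) (by simp [hx, hg]) hl
    simp only [List.map_cons, List.sum_cons]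
    rw [add_right_comm] at h hloop
    rw [← add_assoc, ← add_assoc]
    exact .seq h hloop

variable [Fintype ι]

/-- Empties the counters `e i`, adding the vector `g i` to the counters for each unit removed
from `e i`. -/
noncomputable def distributeAll (e : ι → κ) (g : ι → κ → ℕ) : StackProgram (Tape κ) :=
  distributeList e g Finset.univ.toList

theorem runs_distributeAll {e : ι → κ} (he : Injective e) {g : ι → κ → ℕ}
    (hg : ∀ i j, g i (e j) = 0) (hx : ∀ i, x (e i) = 0) (a : ι → ℕ) :
    Runs (distributeAll e g) (contents w o (x + ∑ i, Pi.single (e i) (a i)))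
      (contents w o (x + ∑ i, a i • g i)) (∑ i, (a i + 1)) := by
  simpa only [distributeAll, Finset.sum_map_toList] using
    runs_distributeList (w := w) (o := o) he hg hx a Finset.univ.nodup_toList

end DistributeAll

/-- Doubles the counter `u`, using the counter `v`. -/
noncomputable def double (u v : κ) : StackProgram (Tape κ) :=
  seq (distribute u (Pi.single v 2)) (distribute v (Pi.single u 1))

theorem runs_double (huv : u ≠ v) (hu : x u = 0) (hv : x v = 0) (m : ℕ) :
    Runs (double u v) (contents w o (x + Pi.single u m)) (contents w o (x + Pi.single u (2 * m)))
      (3 * m + 2) := by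
  have h₁ := runs_distribute (w := w) (o := o) (g := Pi.single v 2) (by simp [huv]) hu m
  have h₂ := runs_distribute (w := w) (o := o) (g := Pi.single u 1) (by simp [huv.symm]) hv (2 * m)
  rw [← Pi.single_smul, smul_eq_mul, mul_comm] at h₁
  rw [← Pi.single_smul, smul_eq_mul, mul_one] at h₂
  exact (Runs.seq h₁ h₂).mono (by omega)

/-- Reads a binary word from the output tape, most significant bit first, into the counter `u`,
using the counter `v`. -/
noncomputable def readBits (u v : κ) : StackProgram (Tape κ) :=
  loop out fun b => seq (double u v) (if b then push (ctr u) true else skip)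

theorem runs_readBits (huv : u ≠ v) (hu : x u = 0) (hv : x v = 0) (l : List Bool) (m : ℕ) :
    Runs (readBits u v) (contents w l (x + Pi.single u m))
      (contents w [] (x + Pi.single u (l.foldl (fun a b => Nat.bit b a) m)))
      (l.length * (3 * l.foldl (fun a b => Nat.bit b a) m + 3) + 1) := by
  induction l generalizing m with
  | nil => exact Runs.mono (.loop_nil rfl) (by simp)
  | cons b l ih =>
    have hbit : Runs (if b then push (ctr u) true else skip)
        (contents w l (x + Pi.single u (2 * m)))
        (contents w l (x + Pi.single u (Nat.bit b m))) 0 := by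
      cases b
      · exact .skip _
      · rw [Nat.bit_true, Pi.single_add, ← add_assoc]
        exact runs_incr
    have hbody := Runs.seq (runs_double (w := w) (o := l) huv hu hv m) hbit
    have hle := (le_foldl_bit [b] m).trans (le_foldl_bit l (Nat.bit b m))
    refine (Runs.loop_out_cons hbody (ih (Nat.bit b m))).mono ?_
    rw [List.length_cons, List.foldl_cons, add_one_mul]
    omega

/-- Reads a binary word from the input tape, least significant bit first, into the counter `u`,
using the counter `v`. -/
noncomputable def readNat (u v : κ) : StackProgram (Tape κ) :=
  seq moveInput (readBits u v)

theorem runs_readNat (huv : u ≠ v) (hu : x u = 0) (hv : x v = 0) (n : ℕ) :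
    Runs (readNat u v) (contents n.bits [] x) (contents [] [] (x + Pi.single u n))
      (3 * (n + 1) ^ 2) := by
  have hmove := runs_moveInput (x := x) n.bits []
  have hread := runs_readBits (w := []) huv hu hv n.bits.reverse 0
  simp only [List.foldl_reverse, List.length_reverse, foldr_bit_bits, Nat.size_eq_bits_len,
    Pi.single_zero, add_zero, List.append_nil] at hmove hread
  have hsize : n.size ≤ n := Nat.size_le.2 Nat.lt_two_pow_self
  exact (Runs.seq hmove hread).mono (by nlinarith)

/-- Moves the counter `r` to the input tape in binary, most significant bit first, using the
counters `u` and `v`. In each round the body, whose loop test has already removed one unit from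
`r`, turns the value `2 * h + b` of `r` into `u = 2 * h + b - 1` and `v = 2 * h + b`, then into
`r = h` and `v = b`. -/
noncomputable def writeBits (r u v : κ) : StackProgram (Tape κ) :=
  loop (ctr r) fun _ => seq (push (ctr v) true) <|
    seq (distribute r (Pi.single u 1 + Pi.single v 1)) <| seq (halve r u v) (pushDigit v)

theorem runs_writeBits (hru : r ≠ u) (hrv : r ≠ v) (huv : u ≠ v) (hr : x r = 0) (hu : x u = 0)
    (hv : x v = 0) (a : ℕ) :
    Runs (writeBits r u v) (contents w o (x + Pi.single r a))
      (contents (a.bits.reverse ++ w) o x) (7 * a + 1) := by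
  induction a using Nat.binaryRec' generalizing w with
  | zero => simpa [writeBits] using Runs.loop_ctr_zero hr
  | bit b h hb ih =>
    have hpos : 2 * h + b.toNat = 2 * h + b.toNat - 1 + 1 := by
      cases b with
      | true => rfl
      | false =>
        have : h ≠ 0 := fun h0 => Bool.false_ne_true (hb h0)
        simp only [Bool.toNat_false]
        omega
    have hdist := runs_distribute (w := w) (o := o) (u := r) (x := x + Pi.single v 1)
      (g := Pi.single u 1 + Pi.single v 1) (by simp [hru, hrv]) (by simp [hr, hrv])
      (2 * h + b.toNat - 1)
    have hspread : x + Pi.single v 1 + (2 * h + b.toNat - 1) • (Pi.single u 1 + Pi.single v 1) =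
        x + Pi.single u (2 * h + b.toNat - 1) + Pi.single v (2 * h + b.toNat) := by
      funext k
      simp only [Pi.add_apply, Pi.smul_apply, smul_eq_mul, Pi.single_apply]
      grind
    rw [hspread, add_right_comm] at hdist
    have hbody := Runs.seq runs_incr (.seq hdist
      (.seq (runs_halve hru hrv huv hu hv h b) (runs_pushDigit (by simp [hv, hrv.symm]) b)))
    have hloop := Runs.loop_ctr_succ hbody (ih (w := b :: w))
    rw [Nat.bits_append_bit h b hb, List.reverse_cons, List.append_assoc, Nat.bit_val, hpos,
      Pi.single_add, ← add_assoc]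
    exact hloop.mono (by omega)

end AddVec

end Counters

end StackProgram

/-! ### A program for a linear recurrence of vectors -/

/-- The counters of the program that iterates a matrix with rows and columns indexed by `ι`: the
number of rounds left, a temporary counter, the current vector, and the next one. -/
inductive Counter (ι : Type) : Type
  | count : Counter ι
  | temp : Counter ι
  | reg (i : ι) : Counter ι
  | acc (i : ι) : Counter ι
  deriving DecidableEq, Fintype

namespace Counter

variable {ι : Type}

/-- The counter values with the vector `a` in the counters `reg i` and `0` elsewhere. -/
def regs (a : ι → ℕ) : Counter ι → ℕ
  | reg i => a i
  | _ => 0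

/-- The counter values with the vector `a` in the counters `acc i` and `0` elsewhere. -/
def accs (a : ι → ℕ) : Counter ι → ℕ
  | acc i => a i
  | _ => 0

variable [DecidableEq ι]

theorem regs_update_add_single (a : ι → ℕ) (i : ι) :
    regs (Function.update a i 0) + Pi.single (reg i) (a i) = regs a := by
  funext u
  rcases u with _ | _ | j | j
  case reg => rcases eq_or_ne j i with rfl | hj <;> simp [regs, *]
  all_goals simp [regs]

theorem regs_update_sub_single (a : ι → ℕ) {i j : ι} (hij : i ≠ j) {m : ℕ} (hm : m + a j = a i) :
    regs (Function.update a j 0) - Pi.single (reg i) (a j) =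
      regs (Function.update (Function.update a j 0) i 0) + Pi.single (reg i) m := by
  funext u
  rcases u with _ | _ | k | k
  case reg =>
    rcases eq_or_ne k i with rfl | hk
    · simp [regs, hij, ← hm]
    · simp [regs, hk]
  all_goals simp [regs]

variable [Fintype ι]

theorem sum_single_reg (a : ι → ℕ) : ∑ i, Pi.single (reg i) (a i) = regs a := by
  funext u
  cases u <;> simp [Finset.sum_apply, regs, Pi.single_apply]

theorem sum_single_acc (a : ι → ℕ) : ∑ i, Pi.single (acc i) (a i) = accs a := by
  funext u
  cases u <;> simp [Finset.sum_apply, accs, Pi.single_apply]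

end Counter

namespace StackProgram

open Tape Counter Matrix

variable {ι : Type} [Fintype ι] [DecidableEq ι] {w o : List Bool}

theorem runs_clear_regs (a : ι → ℕ) :
    Runs (distributeAll reg 0) (contents w o (regs a)) (contents w o 0) (∑ i, (a i + 1)) := by
  simpa [sum_single_reg] using runs_distributeAll (w := w) (o := o) (e := (reg : ι → Counter ι))
    (fun _ _ => reg.inj) (g := 0) (x := 0) (fun _ _ => rfl) (fun _ => rfl) a

/-- Applies the matrix `A` to the vector in the counters `reg i`. -/
noncomputable def applyMatrix (A : Matrix ι ι ℕ) : StackProgram (Tape (Counter ι)) :=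
  seq (distributeAll reg fun j => accs fun i => A i j)
    (distributeAll acc fun i => Pi.single (reg i) 1)

theorem runs_applyMatrix (A : Matrix ι ι ℕ) (a : ι → ℕ) (m : ℕ) :
    Runs (applyMatrix A) (contents w o (Pi.single count m + regs a))
      (contents w o (Pi.single count m + regs (A *ᵥ a)))
      (∑ i, (a i + 1) + ∑ i, ((A *ᵥ a) i + 1)) := by
  have hacc : ∑ j, a j • accs (fun i => A i j) = accs (A *ᵥ a) := by
    funext u
    cases u <;> simp [Finset.sum_apply, accs, mulVec, dotProduct, mul_comm]
  have hreg : ∑ i, (A *ᵥ a) i • (Pi.single (reg i) 1 : Counter ι → ℕ) = regs (A *ᵥ a) := by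
    simp only [← Pi.single_smul, smul_eq_mul, mul_one, sum_single_reg]
  have h₁ := runs_distributeAll (w := w) (o := o) (x := Pi.single count m) (e := reg)
    (fun _ _ => reg.inj) (g := fun j => accs fun i => A i j) (fun _ _ => rfl) (by simp) a
  have h₂ := runs_distributeAll (w := w) (o := o) (x := Pi.single count m) (e := acc)
    (fun _ _ => acc.inj) (g := fun i => Pi.single (reg i) 1) (by simp) (by simp) (A *ᵥ a)
  rw [sum_single_reg, hacc] at h₁
  rw [sum_single_acc, hreg] at h₂
  exact .seq h₁ h₂

/-- Applies the matrix `A` to the vector in the counters `reg i`, as many times as the value of the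
counter `count`. -/
noncomputable def iterateMatrix (A : Matrix ι ι ℕ) : StackProgram (Tape (Counter ι)) :=
  loop (ctr count) fun _ => applyMatrix A

theorem runs_iterateMatrix {A : Matrix ι ι ℕ} {x : ℕ → ι → ℕ} (hx : ∀ n, x (n + 1) = A *ᵥ x n)
    (n : ℕ) :
    Runs (iterateMatrix A) (contents w o (regs (x 0) + Pi.single count n))
      (contents w o (regs (x n)))
      (∑ k ∈ Finset.range n, ∑ i, (x k i + 1) + ∑ k ∈ Finset.range n, ∑ i, (x (k + 1) i + 1) +
        (n + 1)) := by
  induction n generalizing x with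
  | zero => simpa [iterateMatrix] using Runs.loop_ctr_zero (u := count) (x := regs (x 0)) rfl
  | succ n ih =>
    have hbody := runs_applyMatrix (w := w) (o := o) A (x 0) n
    rw [← hx, add_comm, add_comm _ (regs _)] at hbody
    rw [Pi.single_add, ← add_assoc, Finset.sum_range_succ', Finset.sum_range_succ' _ n]
    have hloop := ih (x := fun n => x (n + 1)) fun n => hx (n + 1)
    exact (Runs.loop_ctr_succ hbody hloop).mono (by omega)

/-- Writes to the output tape the difference of the counters `reg i` and `reg j`, and empties all
the counters. -/
noncomputable def writeDifference (i j : ι) : StackProgram (Tape (Counter ι)) :=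
  seq (subtract (reg j) (reg i)) <| seq (writeBits (reg i) count temp) <|
    seq moveInput (distributeAll reg 0)

theorem runs_writeDifference {i j : ι} (hij : i ≠ j) {a : ι → ℕ} {s : ℕ} (hs : s + a j = a i) :
    Runs (writeDifference i j) (contents [] [] (regs a)) (contents [] s.bits 0)
      (10 * ∑ k, (a k + 1)) := by
  let b := Function.update a j 0
  let b' := Function.update b i 0
  have hsub := runs_subtract (w := []) (o := []) (u := reg j) (v := reg i) (x := regs b)
    (by simpa using hij.symm) (by simp [regs, b]) (a j)
  have hwrite := runs_writeBits (w := []) (o := []) (r := reg i) (u := count) (v := temp)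
    (x := regs b') nofun nofun nofun (by simp [regs, b']) rfl rfl s
  have hmove := runs_moveInput (o := []) (x := regs b') s.bits.reverse
  have hclear := runs_clear_regs (w := []) (o := s.bits) b'
  rw [regs_update_add_single, regs_update_sub_single a hij hs] at hsub
  rw [List.append_nil] at hwrite hmove
  rw [List.reverse_reverse, List.length_reverse, Nat.size_eq_bits_len] at hmove
  have hcoord : a i + 1 ≤ ∑ k, (a k + 1) :=
    Finset.single_le_sum (f := fun k => a k + 1) (fun _ _ => Nat.zero_le _) (Finset.mem_univ i)
  have hcleared : ∑ k, (b' k + 1) ≤ ∑ k, (a k + 1) := by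
    gcongr with k
    simp only [b', b, Function.update_apply]
    split_ifs <;> simp
  have hsize : s.size ≤ s := Nat.size_le.2 Nat.lt_two_pow_self
  exact (Runs.seq hsub (.seq hwrite (.seq hmove hclear))).mono (by omega)

/-- Reads `n` from the input tape, computes the vector `A ^ n *ᵥ a`, and writes the difference of
its coordinates `i` and `j` to the output tape. -/
noncomputable def matrixProgram (A : Matrix ι ι ℕ) (a : ι → ℕ) (i j : ι) :
    StackProgram (Tape (Counter ι)) :=
  seq (readNat count temp) <| seq (addVec (regs a)) <| seq (iterateMatrix A) (writeDifference i j)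

theorem runs_matrixProgram {A : Matrix ι ι ℕ} {x : ℕ → ι → ℕ} (hx : ∀ n, x (n + 1) = A *ᵥ x n)
    {i j : ι} (hij : i ≠ j) {s n : ℕ} (hs : s + x n j = x n i) :
    Runs (matrixProgram A (x 0) i j) (contents n.bits [] 0) (contents [] s.bits 0)
      (12 * ((n + 1) ^ 2 + ∑ k ∈ Finset.range (n + 1), ∑ i, (x k i + 1))) := by
  have hread := runs_readNat (x := 0) (u := count (ι := ι)) (v := temp) nofun rfl rfl n
  have hinit := runs_addVec (w := []) (o := []) (x := Pi.single count n) (regs (x 0))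
  have hiter := runs_iterateMatrix (w := []) (o := []) hx n
  rw [zero_add] at hread
  rw [add_comm] at hinit
  refine (Runs.seq hread (.seq hinit (.seq hiter (runs_writeDifference hij hs)))).mono ?_
  have hsucc := Finset.sum_range_succ (fun k => ∑ i, (x k i + 1)) n
  have hsucc' := Finset.sum_range_succ' (fun k => ∑ i, (x k i + 1)) n
  have hsq : n + 1 ≤ (n + 1) ^ 2 := Nat.le_self_pow two_ne_zero _
  omega

end StackProgram

/-! ### Bounds by iterated exponentials -/

theorem add_le_expTower (k n : ℕ) : n + k ≤ expTower k n := by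
  induction k with
  | zero => rfl
  | succ k ih => exact (Nat.lt_two_pow_self (n := n + k)).trans_le (Nat.pow_le_pow_right two_pos ih)

theorem mul_add_le_expTower (a b n : ℕ) : a * n + b ≤ expTower (a + b + 1) n := calc
  a * n + b ≤ (a + b) * (n + 1) := by lia
  _ ≤ 2 ^ (a + b) * 2 ^ n := Nat.mul_le_mul Nat.lt_two_pow_self.le Nat.lt_two_pow_self
  _ = 2 ^ (n + (a + b)) := by rw [← pow_add, add_comm]
  _ ≤ expTower (a + b + 1) n := Nat.pow_le_pow_right two_pos (add_le_expTower _ n)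

theorem exists_lt_expTower {f : ℕ → ℕ} {C : ℕ} (hf : ∀ n, f (n + 1) ≤ C * f n) :
    ∃ k, ∀ n, f n < expTower k n := by
  have hpow (n : ℕ) : f n ≤ C ^ n * f 0 := by
    induction n with
    | zero => simp
    | succ n ih =>
      rw [pow_succ', mul_assoc]
      exact (hf n).trans (Nat.mul_le_mul_left C ih)
  refine ⟨C + f 0 + 1 + 1, fun n => ?_⟩
  calc
    f n ≤ C ^ n * f 0 := hpow n
    _ ≤ (2 ^ C) ^ n * f 0 := by
      gcongr
      exact Nat.lt_two_pow_self.le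
    _ < (2 ^ C) ^ n * 2 ^ f 0 := Nat.mul_lt_mul_of_pos_left Nat.lt_two_pow_self (by positivity)
    _ = 2 ^ (C * n + f 0) := by rw [← pow_mul, ← pow_add]
    _ ≤ expTower (C + f 0 + 1 + 1) n := Nat.pow_le_pow_right two_pos (mul_add_le_expTower ..)

theorem exists_sq_add_sum_lt_expTower {c : ℕ → ℕ} {C : ℕ} (hc : ∀ n, c (n + 1) ≤ C * c n) (a : ℕ) :
    ∃ k, ∀ n, a * ((n + 1) ^ 2 + ∑ m ∈ Finset.range (n + 1), c m) < expTower k n := by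
  refine exists_lt_expTower (C := C + 4) fun n => ?_
  have hlast : c n ≤ ∑ m ∈ Finset.range (n + 1), c m :=
    Finset.single_le_sum (fun _ _ => Nat.zero_le _) (Finset.self_mem_range_succ n)
  have hnext := (hc n).trans (Nat.mul_le_mul_left C hlast)
  rw [mul_left_comm, Finset.sum_range_succ _ (n + 1)]
  refine Nat.mul_le_mul_left a ?_
  rw [mul_add, add_mul C, add_mul C]
  lia

open Matrix in
theorem sum_mulVec_add_one_le {ι : Type*} [Fintype ι] (A : Matrix ι ι ℕ) (a : ι → ℕ) :
    ∑ i, ((A *ᵥ a) i + 1) ≤ (∑ i, (∑ j, A i j + 1)) * ∑ i, (a i + 1) := by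
  have hcoord (j : ι) : a j + 1 ≤ ∑ i, (a i + 1) :=
    Finset.single_le_sum (f := fun i => a i + 1) (fun _ _ => Nat.zero_le _) (Finset.mem_univ j)
  rw [Finset.sum_mul]
  refine Finset.sum_le_sum fun i _ => ?_
  rw [add_one_mul, Finset.sum_mul]
  exact add_le_add (Finset.sum_le_sum fun j _ => Nat.mul_le_mul_left _ (Nat.le_of_lt (hcoord j)))
    ((Nat.le_add_left 1 _).trans (hcoord i))

/-! ### Kalmar functions -/

theorem isKalmarFunction_of_runs {κ : Type} [Finite κ] [DecidableEq κ]
    {c : StackProgram (Tape κ)} {s t : ℕ → ℕ} {k : ℕ} (ht : ∀ n, t n < expTower k n)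
    (hc : ∀ n, c.Runs (Tape.contents n.bits [] 0) (Tape.contents [] (s n).bits 0) (t n)) :
    IsKalmarFunction s := by
  have := Fintype.ofFinite κ
  refine ⟨⟨c.machine .inp .out, .refl Bool, .refl Bool⟩, k, fun n => ?_⟩
  have hrun := hc n
  have hid (l : List Bool) : l.map (Equiv.refl Bool).symm = l := List.map_id l
  rw [← Tape.update_inp [] [] n.bits, ← Tape.update_out [] [] (s n).bits,
    Tape.contents_nil_nil_zero, ← encodeNat_eq_bits, ← encodeNat_eq_bits,
    ← hid (Computability.encodeNat n), ← hid (Computability.encodeNat (s n))] at hrun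
  obtain ⟨h⟩ := hrun.outputsInTime
  exact ⟨h.toEvalsTo, h.steps_le_m.trans (ht n)⟩

open Matrix in
theorem isKalmarFunction_of_nat_matrix {ι : Type} [Fintype ι] {A : Matrix ι ι ℕ}
    {x : ℕ → ι → ℕ} (hx : ∀ n, x (n + 1) = A *ᵥ x n) {i j : ι} (hij : i ≠ j) {s : ℕ → ℕ}
    (hs : ∀ n, s n + x n j = x n i) : IsKalmarFunction s := by
  classical
  have hgrowth (n : ℕ) : ∑ i, (x (n + 1) i + 1) ≤ (∑ i, (∑ j, A i j + 1)) * ∑ i, (x n i + 1) := by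
    rw [hx]
    exact sum_mulVec_add_one_le A (x n)
  obtain ⟨k, hk⟩ := exists_sq_add_sum_lt_expTower (c := fun n => ∑ i, (x n i + 1)) hgrowth 12
  exact isKalmarFunction_of_runs hk fun n => StackProgram.runs_matrixProgram hx hij (hs n)

theorem mainTheorem6 {R : Type*} [Ring R] [CharZero R] (s : ℕ → ℕ)
    (hs : IsCRecursive (fun n => (s n : R))) : IsKalmarFunction s := by
  obtain ⟨ι, _, A, x, i, j, hx, hij, hsx⟩ := hs.exists_nat_matrix
  exact isKalmarFunction_of_nat_matrix hx hij hsx
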